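/- Let $a_n>0$ and $b_n\in\mathbb R$ ($n=0,1,2,\dots$). For $z\in\mathbb C$ let $p_n(z)$ and $q_n(z)$ be the solutions of the Jacobi equation $$a_{n-1}u_{n-1}+b_nu_n+a_nu_{n+1}=zu_n,\qquad n\ge 1,$$ with $p_0(z)=1$, $p_1(z)=(z-b_0)/a_0$ and $q_0(z)=0$, $q_1(z)=1/a_0$. For two solutions $u,v$ of this equation let $\{u,v\}=a_n(u_nv_{n+1}-u_{n+1}v_n)$ be their Wronskian, which does not depend on $n\ge 0$. Put $\beta_n=-\dfrac{b_n}{2\sqrt{a_{n-1}a_n}}$ for $n\ge1$, let $\beta_0\in\mathbb R$ be arbitrary (there is no $a_{-1}$), and put $\alpha_n=\sqrt{a_{n+1}/a_n}$ for $n\ge 0$, $k_n=\alpha_{n-1}/\alpha_n$ for $n\ge 1$. Assume that $$\sum_{n}a_n^{-1}<\infty,\qquad \beta_n\to\beta_\infty\ \text{ with } |\beta_\infty|<1,\qquad \sum_{n}|k_n-1|<\infty,\qquad \sum_{n}|\beta_{n+1}-\beta_n|<\infty .$$ Let $\varphi_n=\sum_{0\le m\le n-1,\ |\beta_m|\le 1}\arccos\beta_m$.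 Then the finite limit $\alpha_\infty=\lim_{n\to\infty}\alpha_n$ exists and $\alpha_\infty\ge1$. For each $z\in\mathbb C$ there are unique solutions $f^{(+)}(z)$ and $f^{(-)}(z)$ of the Jacobi equation (the Jost solutions) with $$f_n^{(\pm)}(z)=a_n^{-1/2}e^{\pm i\varphi_n}(1+o(1)),\qquad n\to\infty,$$ and $\{f^{(+)}(z),f^{(-)}(z)\}=-2i\alpha_\infty^{-1}\sqrt{1-\beta_\infty^2}$. The functions $$\sigma_+(z)=-\alpha_\infty\frac{\{p(z),f^{(-)}(z)\}}{2i\sqrt{1-\beta_\infty^2}},\qquad \sigma_-(z)=\alpha_\infty\frac{\{p(z),f^{(+)}(z)\}}{2i\sqrt{1-\beta_\infty^2}},$$ $$\tau_+(z)=-\alpha_\infty\frac{\{q(z),f^{(-)}(z)\}}{2i\sqrt{1-\beta_\infty^2}},\qquad \tau_-(z)=\alpha_\infty\frac{\{q(z),f^{(+)}(z)\}}{2i\sqrt{1-\beta_\infty^2}}$$ are entire, and for all $z\in\mathbb C$ and $n\ge 0$ $$p_n(z)=\sigma_+(z)f_n^{(+)}(z)+\sigma_-(z)f_n^{(-)}(z),\qquad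 q_n(z)=\tau_+(z)f_n^{(+)}(z)+\tau_-(z)f_n^{(-)}(z).$$ For every $z\in\mathbb C$, as $n\to\infty$, $$p_n(z)=a_n^{-1/2}\bigl(\sigma_+(z)e^{i\varphi_n}+\sigma_-(z)e^{-i\varphi_n}+o(1)\bigr),\qquad q_n(z)=a_n^{-1/2}\bigl(\tau_+(z)e^{i\varphi_n}+\tau_-(z)e^{-i\varphi_n}+o(1)\bigr).$$ -/

import Mathlib

open Filter Topology Complex

noncomputable section

/-- `u = (u_0, u_1, …)` solves the Jacobi difference equation
`a_{n-1} u_{n-1} + b_n u_n + a_n u_{n+1} = z u_n` for all `n ≥ 1` (indices are shifted by one). -/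
def IsJacobiSolution (a b : ℕ → ℝ) (z : ℂ) (u : ℕ → ℂ) : Prop :=
  ∀ n : ℕ, (a n : ℂ) * u n + (b (n + 1) : ℂ) * u (n + 1) + (a (n + 1) : ℂ) * u (n + 2)
    = z * u (n + 1)

/-- The sequence with prescribed values `u_0`, `u_1` that satisfies the Jacobi difference
equation for all `n ≥ 1`. -/
def jacobiRec (a b : ℕ → ℝ) (z u₀ u₁ : ℂ) : ℕ → ℂ
  | 0 => u₀
  | 1 => u₁
  | n + 2 => ((z - (b (n + 1) : ℂ)) * jacobiRec a b z u₀ u₁ (n + 1)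
      - (a n : ℂ) * jacobiRec a b z u₀ u₁ n) / (a (n + 1) : ℂ)

/-- Orthogonal polynomials of the first kind: `p_0 = 1`, `p_1 = (z - b_0) / a_0`. -/
def jacobiP (a b : ℕ → ℝ) (z : ℂ) : ℕ → ℂ :=
  jacobiRec a b z 1 ((z - (b 0 : ℂ)) / (a 0 : ℂ))

/-- Orthogonal polynomials of the second kind: `q_0 = 0`, `q_1 = 1 / a_0`. -/
def jacobiQ (a b : ℕ → ℝ) (z : ℂ) : ℕ → ℂ :=
  jacobiRec a b z 0 (1 / (a 0 : ℂ))

/-- The Wronskian `a_n (u_n v_{n+1} - u_{n+1} v_n)`, which for two solutions of the same Jacobi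
equation does not depend on `n`. -/
def jacobiWronskian (a : ℕ → ℝ) (u v : ℕ → ℂ) (n : ℕ) : ℂ :=
  (a n : ℂ) * (u n * v (n + 1) - u (n + 1) * v n)

/-- `α_n = √(a_{n+1} / a_n)`. -/
def jacobiAlpha (a : ℕ → ℝ) (n : ℕ) : ℝ := √(a (n + 1) / a n)

/-- `k_n = α_{n-1} / α_n` for `n ≥ 1`; the value at `n = 0`, where there is no `α_{-1}`, is set
to `1`. -/
def jacobiK (a : ℕ → ℝ) : ℕ → ℝ
  | 0 => 1
  | n + 1 => jacobiAlpha a n / jacobiAlpha a (n + 1)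

/-- `β_n = - b_n / (2 √(a_{n-1} a_n))` for `n ≥ 1`. As there is no `a_{-1}`, the value `β_0` is a
free parameter. -/
def jacobiBeta (a b : ℕ → ℝ) (β₀ : ℝ) : ℕ → ℝ
  | 0 => β₀
  | n + 1 => - b (n + 1) / (2 * √(a n * a (n + 1)))

/-- `φ_n = ∑ arccos β_m`, the sum over those `0 ≤ m ≤ n - 1` for which `|β_m| ≤ 1`. -/
def jacobiPhase (a b : ℕ → ℝ) (β₀ : ℝ) (n : ℕ) : ℝ :=
  ∑ m ∈ Finset.range n with |jacobiBeta a b β₀ m| ≤ 1, Real.arccos (jacobiBeta a b β₀ m)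

/-- `f` is a Jost solution of the Jacobi equation: `f_n = a_n^{-1/2} e^{i s φ_n} (1 + o(1))` as
`n → ∞`. The two Jost solutions `f^{(+)}`, `f^{(-)}` are those for `s = 1` and `s = -1`. -/
def IsJostSolution (a b : ℕ → ℝ) (β₀ : ℝ) (s : ℤ) (z : ℂ) (f : ℕ → ℂ) : Prop :=
  IsJacobiSolution a b z f ∧
    ∃ ε : ℕ → ℂ, Tendsto ε atTop (𝓝 0) ∧
      ∀ n, f n = ((1 / √(a n) : ℝ) : ℂ) * exp ((s : ℂ) * I * (jacobiPhase a b β₀ n : ℂ)) *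
        (1 + ε n)

/-- `u_n = a_n^{-1/2} (c₊ e^{i φ_n} + c₋ e^{-i φ_n} + o(1))` as `n → ∞`. -/
def HasJostAsymptotics (a b : ℕ → ℝ) (β₀ : ℝ) (u : ℕ → ℂ) (cp cm : ℂ) : Prop :=
  ∃ ε : ℕ → ℂ, Tendsto ε atTop (𝓝 0) ∧
    ∀ n, u n = ((1 / √(a n) : ℝ) : ℂ) *
      (cp * exp (I * (jacobiPhase a b β₀ n : ℂ)) + cm * exp (-I * (jacobiPhase a b β₀ n : ℂ))
        + ε n)

end

/-! Put `y_n = √a_n u_n`. The Jacobi equation becomes a small perturbation of `y_{n+2} - 2β_{n+1}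
y_{n+1} + y_n = 0`, whose characteristic roots are `β ± i√(1 - β²) = e^{±i arccos β}`. Variation of
parameters writes both `y_n` and `y_{n+1}` with one pair `(c_n, d_n)` against `e^{±iφ}`. The step of
this pair is at most a summable sequence times `(1 + ‖z‖)‖(c_n, d_n)‖`: the errors come from `k_n -
1`, from `z / √(a_n a_{n+1})` and from the variation of `β_n`. Hence the pair converges locally
uniformly in `z`, and its limits are entire (`exists_hasJostAsymptotics`). Applied to `p` and `q`,
this gives `σ±` and `τ±` directly.

The Wronskian, being constant, equals its limit, which is a fixed nonzero multiple of the
determinant of the asymptotic coefficients (`jacobiWronskian_eq_of_hasJostAsymptotics`). As `{p, q}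
= 1`, the matrix of `σ±, τ±` is invertible, so combinations of `p` and `q` give the Jost solutions.
A solution with zero coefficients has zero Wronskian with `p` and `q`, hence vanishes
(`eq_of_hasJostAsymptotics`). The remaining formulas follow from these two facts. -/

/-! ### Discrete Gronwall estimates and holomorphic limits -/

section Perturbation

variable {E : Type*} [NormedAddCommGroup E]

lemma norm_le_exp_tsum_mul_of_norm_sub_le {x : ℕ → E} {e : ℕ → ℝ} (he : ∀ n, 0 ≤ e n)
    (hs : Summable e) (h : ∀ n, ‖x (n + 1) - x n‖ ≤ e n * ‖x n‖) (n : ℕ) :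
    ‖x n‖ ≤ Real.exp (∑' i, e i) * ‖x 0‖ := by
  have key : ‖x n‖ ≤ Real.exp (∑ i ∈ Finset.range n, e i) * ‖x 0‖ := by
    induction n with
    | zero => simp
    | succ n ih =>
      have h1 : ‖x (n + 1)‖ ≤ (e n + 1) * ‖x n‖ := by
        have := norm_le_norm_add_norm_sub' (x (n + 1)) (x n)
        linarith [h n]
      calc ‖x (n + 1)‖ ≤ (e n + 1) * ‖x n‖ := h1
        _ ≤ Real.exp (e n) * (Real.exp (∑ i ∈ Finset.range n, e i) * ‖x 0‖) := by
          gcongr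
          exact Real.add_one_le_exp _
        _ = _ := by rw [Finset.sum_range_succ, Real.exp_add]; ring
  refine key.trans ?_
  gcongr
  exact hs.sum_le_tsum _ fun i _ => he i

lemma exists_tendsto_of_norm_sub_le [CompleteSpace E] {x : ℕ → E} {e : ℕ → ℝ}
    (he : ∀ n, 0 ≤ e n) (hs : Summable e) (h : ∀ n, ‖x (n + 1) - x n‖ ≤ e n * ‖x n‖) :
    ∃ l, Tendsto x atTop (𝓝 l) := by
  refine cauchySeq_tendsto_of_complete (cauchySeq_of_dist_le_of_summable
    (fun n => e n * (Real.exp (∑' i, e i) * ‖x 0‖)) (fun n => ?_) (hs.mul_right _))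
  rw [dist_comm, dist_eq_norm]
  exact (h n).trans (mul_le_mul_of_nonneg_left
    (norm_le_exp_tsum_mul_of_norm_sub_le he hs h n) (he n))

/-- On a ball the Gronwall bound is uniform in `z`, so the Weierstrass M-test applies to the
telescoping series of increments. -/
lemma exists_differentiable_tendsto_of_norm_sub_le [NormedSpace ℂ E] [CompleteSpace E]
    {C : ℕ → ℂ → E} (hC : ∀ n, Differentiable ℂ (C n)) {e : ℕ → ℝ} (he : ∀ n, 0 ≤ e n)
    (hs : Summable e) (h : ∀ n z, ‖C (n + 1) z - C n z‖ ≤ e n * (1 + ‖z‖) * ‖C n z‖) :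
    ∃ L : ℂ → E, Differentiable ℂ L ∧ ∀ z, Tendsto (fun n => C n z) atTop (𝓝 (L z)) := by
  have hlim : ∀ z, ∃ l, Tendsto (fun n => C n z) atTop (𝓝 l) := fun z =>
    exists_tendsto_of_norm_sub_le (e := fun n => e n * (1 + ‖z‖))
      (fun n => mul_nonneg (he n) (by positivity)) (hs.mul_right _) (fun n => h n z)
  choose L hL using hlim
  refine ⟨L, fun z₀ => ?_, hL⟩
  -- Any ball around the origin that contains `z₀` would do; centring it at `0` bounds the factor `1
  -- + ‖z‖` by `1 + R`.
  set R : ℝ := ‖z₀‖ + 1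
  obtain ⟨B, hB⟩ := (isCompact_closedBall (0 : ℂ) R).exists_bound_of_continuousOn
    (hC 0).continuous.continuousOn
  have hbound : ∀ n, ∀ z ∈ Metric.ball (0 : ℂ) R, ‖C (n + 1) z - C n z‖ ≤
      e n * (1 + R) * (Real.exp (∑' i, e i * (1 + R)) * B) := by
    intro n z hz
    have hzR : ‖z‖ ≤ R := by simpa using (Metric.mem_ball.1 hz).le
    have h1 : ∀ n, ‖C (n + 1) z - C n z‖ ≤ e n * (1 + R) * ‖C n z‖ := fun n =>
      (h n z).trans (by have := he n; gcongr)
    have hR : 0 ≤ 1 + R := by positivity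
    refine (h1 n).trans (mul_le_mul_of_nonneg_left ?_ (mul_nonneg (he n) hR))
    refine (norm_le_exp_tsum_mul_of_norm_sub_le (x := fun n => C n z) (e := fun n => e n * (1 + R))
      (fun n => mul_nonneg (he n) hR) (hs.mul_right _) h1 n).trans ?_
    gcongr
    exact hB z (Metric.ball_subset_closedBall hz)
  have hsum : Summable fun n => e n * (1 + R) * (Real.exp (∑' i, e i * (1 + R)) * B) :=
    (hs.mul_right _).mul_right _
  have hd := differentiableOn_tsum_of_summable_norm hsum
    (fun n => ((hC (n + 1)).sub (hC n)).differentiableOn) Metric.isOpen_ball hbound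
  have hmem : Metric.ball (0 : ℂ) R ∈ 𝓝 z₀ :=
    Metric.isOpen_ball.mem_nhds (by simp [R])
  refine (((hC 0).differentiableAt).add (hd.differentiableAt hmem)).congr_of_eventuallyEq ?_
  filter_upwards [hmem] with z hz
  have h1 : Summable fun n => C (n + 1) z - C n z :=
    Summable.of_norm_bounded hsum fun n => hbound n z hz
  have h2 := h1.hasSum.tendsto_sum_nat
  simp only [Finset.sum_range_sub (fun n => C n z)] at h2
  have h3 := (hL z).sub_const (C 0 z)
  have := tendsto_nhds_unique h3 h2
  simp only [Pi.add_apply, Pi.sub_apply]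
  rw [← this]; abel

end Perturbation

/-! ### Algebra of solutions and their Wronskians -/

section Wronskian

variable {a b : ℕ → ℝ} {z : ℂ} {u v : ℕ → ℂ}

lemma IsJacobiSolution.linearCombination (hu : IsJacobiSolution a b z u)
    (hv : IsJacobiSolution a b z v) (c d : ℂ) :
    IsJacobiSolution a b z fun n => c * u n + d * v n := fun n => by
  linear_combination c * hu n + d * hv n

lemma isJacobiSolution_jacobiRec (ha : ∀ n, 0 < a n) (u₀ u₁ : ℂ) :
    IsJacobiSolution a b z (jacobiRec a b z u₀ u₁) := fun n => by
  have : (a (n + 1) : ℂ) ≠ 0 := ofReal_ne_zero.2 (ha _).ne'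
  rw [jacobiRec, mul_div_cancel₀ _ this]
  ring

lemma differentiable_jacobiRec (u₀ : ℂ) {u₁ : ℂ → ℂ} (h₁ : Differentiable ℂ u₁) (n : ℕ) :
    Differentiable ℂ fun z => jacobiRec a b z u₀ (u₁ z) n := by
  induction n using Nat.twoStepInduction with
  | zero => simp only [jacobiRec]; fun_prop
  | one => simpa only [jacobiRec] using h₁
  | more n h1 h2 => simp only [jacobiRec]; fun_prop

lemma IsJacobiSolution.eq_zero (ha : ∀ n, 0 < a n) (hu : IsJacobiSolution a b z u)
    (h0 : u 0 = 0) (h1 : u 1 = 0) (n : ℕ) : u n = 0 := by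
  induction n using Nat.twoStepInduction with
  | zero => exact h0
  | one => exact h1
  | more n h h' =>
    have := hu n
    simpa [h, h', (ha _).ne'] using this

lemma IsJacobiSolution.wronskian_eq (hu : IsJacobiSolution a b z u)
    (hv : IsJacobiSolution a b z v) (n : ℕ) :
    jacobiWronskian a u v n = jacobiWronskian a u v 0 := by
  induction n with
  | zero => rfl
  | succ n ih =>
    rw [← ih]
    unfold jacobiWronskian
    linear_combination u (n + 1) * hv n - v (n + 1) * hu n

lemma jacobiWronskian_jacobiP_jacobiQ (ha : ∀ n, 0 < a n) :
    jacobiWronskian a (jacobiP a b z) (jacobiQ a b z) 0 = 1 := by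
  have : (a 0 : ℂ) ≠ 0 := ofReal_ne_zero.2 (ha _).ne'
  simp [jacobiWronskian, jacobiP, jacobiQ, jacobiRec, this]

end Wronskian

/-! ### Asymptotic coefficients determine Wronskians and solutions -/

section Asymptotics

variable {a b : ℕ → ℝ} {β₀ : ℝ} {z : ℂ} {u v : ℕ → ℂ} {cp cm dp dm : ℂ}

lemma HasJostAsymptotics.linearCombination (hu : HasJostAsymptotics a b β₀ u cp cm)
    (hv : HasJostAsymptotics a b β₀ v dp dm) (c d : ℂ) :
    HasJostAsymptotics a b β₀ (fun n => c * u n + d * v n) (c * cp + d * dp)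
      (c * cm + d * dm) := by
  obtain ⟨ε, hε, hu⟩ := hu
  obtain ⟨η, hη, hv⟩ := hv
  refine ⟨fun n => c * ε n + d * η n, ?_, fun n => ?_⟩
  · simpa using (hε.const_mul c).add (hη.const_mul d)
  · simp only [hu, hv]; ring

lemma norm_exp_neg_I_mul_ofReal (x : ℝ) : ‖exp (-I * (x : ℂ))‖ = 1 := by
  have := norm_exp_ofReal_mul_I (-x)
  rwa [ofReal_neg, neg_mul_comm, mul_comm] at this

lemma tendsto_mul_zero_of_norm_le_one {e x : ℕ → ℂ} (he : ∀ n, ‖e n‖ ≤ 1)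
    (hx : Tendsto x atTop (𝓝 0)) : Tendsto (fun n => e n * x n) atTop (𝓝 0) := by
  refine squeeze_zero_norm (fun n => ?_) (tendsto_zero_iff_norm_tendsto_zero.1 hx)
  rw [norm_mul]
  exact mul_le_of_le_one_left (norm_nonneg _) (he n)

/-- The exponential is unimodular, so a relative error `1 + o(1)` and an additive error `o(1)` are
interchangeable. -/
lemma isJostSolution_one_iff :
    IsJostSolution a b β₀ 1 z u ↔ IsJacobiSolution a b z u ∧ HasJostAsymptotics a b β₀ u 1 0 := by
  refine and_congr_right fun _ => ⟨?_, ?_⟩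
  · rintro ⟨ε, hε, h⟩
    refine ⟨fun n => exp (I * (jacobiPhase a b β₀ n : ℂ)) * ε n,
      tendsto_mul_zero_of_norm_le_one (fun n => (norm_exp_I_mul_ofReal _).le) hε, fun n => ?_⟩
    rw [h]; push_cast; ring_nf
  · rintro ⟨ε, hε, h⟩
    refine ⟨fun n => exp (-I * (jacobiPhase a b β₀ n : ℂ)) * ε n,
      tendsto_mul_zero_of_norm_le_one (fun n => (norm_exp_neg_I_mul_ofReal _).le) hε, fun n => ?_⟩
    have : exp (I * (jacobiPhase a b β₀ n : ℂ)) * exp (-I * (jacobiPhase a b β₀ n : ℂ)) = 1 := by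
      rw [← Complex.exp_add]; simp
    rw [h, Int.cast_one, one_mul I]
    linear_combination (-((1 / √(a n) : ℝ) : ℂ) * ε n) * this

lemma isJostSolution_neg_one_iff :
    IsJostSolution a b β₀ (-1) z u ↔
      IsJacobiSolution a b z u ∧ HasJostAsymptotics a b β₀ u 0 1 := by
  refine and_congr_right fun _ => ⟨?_, ?_⟩
  · rintro ⟨ε, hε, h⟩
    refine ⟨fun n => exp (-I * (jacobiPhase a b β₀ n : ℂ)) * ε n,
      tendsto_mul_zero_of_norm_le_one (fun n => (norm_exp_neg_I_mul_ofReal _).le) hε, fun n => ?_⟩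
    rw [h]; push_cast; ring_nf
  · rintro ⟨ε, hε, h⟩
    refine ⟨fun n => exp (I * (jacobiPhase a b β₀ n : ℂ)) * ε n,
      tendsto_mul_zero_of_norm_le_one (fun n => (norm_exp_I_mul_ofReal _).le) hε, fun n => ?_⟩
    have : exp (I * (jacobiPhase a b β₀ n : ℂ)) * exp (-I * (jacobiPhase a b β₀ n : ℂ)) = 1 := by
      rw [← Complex.exp_add]; simp
    rw [h, Int.cast_neg, Int.cast_one, neg_one_mul]
    linear_combination (-((1 / √(a n) : ℝ) : ℂ) * ε n) * this

/-- `e^{i arccos β} = β + i √(1 - β²)`. -/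
lemma exp_I_mul_arccos {β : ℝ} (h : |β| ≤ 1) :
    exp (I * (Real.arccos β : ℂ)) = β + I * (√(1 - β ^ 2) : ℝ) := by
  rw [mul_comm, Complex.exp_mul_I, ← ofReal_cos, ← ofReal_sin, Real.cos_arccos (abs_le.1 h).1
    (abs_le.1 h).2, Real.sin_arccos]
  ring

lemma exp_neg_I_mul_arccos {β : ℝ} (h : |β| ≤ 1) :
    exp (-I * (Real.arccos β : ℂ)) = β - I * (√(1 - β ^ 2) : ℝ) := by
  rw [neg_mul_comm, mul_comm, Complex.exp_mul_I, Complex.cos_neg, Complex.sin_neg, ← ofReal_cos,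
    ← ofReal_sin, Real.cos_arccos (abs_le.1 h).1 (abs_le.1 h).2, Real.sin_arccos]
  ring

lemma jacobiPhase_succ {n : ℕ} (h : |jacobiBeta a b β₀ n| ≤ 1) :
    jacobiPhase a b β₀ (n + 1) = jacobiPhase a b β₀ n + Real.arccos (jacobiBeta a b β₀ n) := by
  unfold jacobiPhase
  rw [Finset.range_add_one, Finset.filter_insert, if_pos h, Finset.sum_insert (by simp), add_comm]

lemma exp_I_mul_jacobiPhase_succ {n : ℕ} (h : |jacobiBeta a b β₀ n| ≤ 1) :
    exp (I * (jacobiPhase a b β₀ (n + 1) : ℂ)) = exp (I * (jacobiPhase a b β₀ n : ℂ)) *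
      (jacobiBeta a b β₀ n + I * (√(1 - jacobiBeta a b β₀ n ^ 2) : ℝ)) := by
  rw [jacobiPhase_succ h, ofReal_add, mul_add, Complex.exp_add, exp_I_mul_arccos h]

lemma exp_neg_I_mul_jacobiPhase_succ {n : ℕ} (h : |jacobiBeta a b β₀ n| ≤ 1) :
    exp (-I * (jacobiPhase a b β₀ (n + 1) : ℂ)) = exp (-I * (jacobiPhase a b β₀ n : ℂ)) *
      (jacobiBeta a b β₀ n - I * (√(1 - jacobiBeta a b β₀ n ^ 2) : ℝ)) := by
  rw [jacobiPhase_succ h, ofReal_add, mul_add, Complex.exp_add, exp_neg_I_mul_arccos h]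

/-- The main terms oscillate and need not converge, so limit laws do not apply to the factors;
boundedness is enough to kill the cross terms. -/
lemma tendsto_mul_sub_mul {y y' w w' ε ε' η η' : ℕ → ℂ} {B B' : ℝ} {L : ℂ}
    (hy : ∀ n, ‖y n‖ ≤ B) (hw : ∀ n, ‖w n‖ ≤ B') (hy' : ∀ n, ‖y' n‖ ≤ B) (hw' : ∀ n, ‖w' n‖ ≤ B')
    (hε : Tendsto ε atTop (𝓝 0)) (hε' : Tendsto ε' atTop (𝓝 0))
    (hη : Tendsto η atTop (𝓝 0)) (hη' : Tendsto η' atTop (𝓝 0))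
    (h : Tendsto (fun n => y n * w' n - y' n * w n) atTop (𝓝 L)) :
    Tendsto (fun n => (y n + ε n) * (w' n + η' n) - (y' n + ε' n) * (w n + η n)) atTop
      (𝓝 L) := by
  have key : ∀ {x e : ℕ → ℂ} {K : ℝ}, (∀ n, ‖x n‖ ≤ K) → Tendsto e atTop (𝓝 0) →
      Tendsto (fun n => x n * e n) atTop (𝓝 0) := by
    intro x e K hx he
    have := (tendsto_zero_iff_norm_tendsto_zero.1 he).const_mul K
    rw [mul_zero] at this
    refine squeeze_zero_norm (fun n => ?_) this
    rw [norm_mul]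
    exact mul_le_mul_of_nonneg_right (hx n) (norm_nonneg _)
  have := (((((h.add (key hy hη')).add (key hw' hε)).add (hε.mul hη')).sub (key hy' hη)).sub
    (key hw hε')).sub (hε'.mul hη)
  simp only [add_zero, mul_zero, sub_zero] at this
  exact this.congr fun n => by ring

/-- The prefactor is `a_n / √(a_n a_{n+1}) = 1 / α_n`, and once `|β_n| ≤ 1` the oscillations cancel:
`e_n m_{n+1} - e_{n+1} m_n = -2i√(1 - β_n²)`. -/
lemma jacobiWronskian_eq_of_hasJostAsymptotics (ha : ∀ n, 0 < a n) {βinf αinf : ℝ}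
    (hβ : Tendsto (jacobiBeta a b β₀) atTop (𝓝 βinf)) (hβinf : |βinf| < 1)
    (hα : Tendsto (jacobiAlpha a) atTop (𝓝 αinf)) (hα0 : αinf ≠ 0)
    (hu : IsJacobiSolution a b z u) (hv : IsJacobiSolution a b z v)
    (hu' : HasJostAsymptotics a b β₀ u cp cm) (hv' : HasJostAsymptotics a b β₀ v dp dm) (n : ℕ) :
    jacobiWronskian a u v n =
      -(2 * I * ((√(1 - βinf ^ 2) : ℝ) : ℂ)) / (αinf : ℂ) * (cp * dm - cm * dp) := by
  obtain ⟨ε, hε, hu'⟩ := hu'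
  obtain ⟨η, hη, hv'⟩ := hv'
  set e : ℕ → ℂ := fun n => exp (I * (jacobiPhase a b β₀ n : ℂ)) with he
  set m : ℕ → ℂ := fun n => exp (-I * (jacobiPhase a b β₀ n : ℂ)) with hm
  have hem : ∀ n, e n * m n = 1 := fun n => by simp only [he, hm, ← Complex.exp_add]; simp
  have hbd : ∀ (c d : ℂ) n, ‖c * e n + d * m n‖ ≤ ‖c‖ + ‖d‖ := fun c d n => by
    refine (norm_add_le _ _).trans ?_
    simp only [he, hm, norm_mul, norm_exp_I_mul_ofReal, norm_exp_neg_I_mul_ofReal, mul_one, le_refl]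
  have hev : ∀ᶠ n in atTop, |jacobiBeta a b β₀ n| ≤ 1 :=
    (hβ.abs.eventually (gt_mem_nhds hβinf)).mono fun n hn => hn.le
  have hγ : Tendsto (fun n => ((√(1 - jacobiBeta a b β₀ n ^ 2) : ℝ) : ℂ)) atTop
      (𝓝 ((√(1 - βinf ^ 2) : ℝ) : ℂ)) :=
    (continuous_ofReal.tendsto _).comp (((hβ.pow 2).const_sub 1).sqrt)
  have hmain : Tendsto (fun n => (cp * e n + cm * m n) * (dp * e (n + 1) + dm * m (n + 1)) -
      (cp * e (n + 1) + cm * m (n + 1)) * (dp * e n + dm * m n)) atTop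
      (𝓝 (-(2 * I * ((√(1 - βinf ^ 2) : ℝ) : ℂ)) * (cp * dm - cm * dp))) := by
    refine (((hγ.const_mul (2 * I)).neg).mul_const _).congr' ?_
    filter_upwards [hev] with n hn
    simp only [he, hm, exp_I_mul_jacobiPhase_succ hn, exp_neg_I_mul_jacobiPhase_succ hn]
    have := hem n
    simp only [he, hm] at this
    linear_combination (-(2 * I * ((√(1 - jacobiBeta a b β₀ n ^ 2) : ℝ) : ℂ)) *
      (cp * dm - cm * dp)) * (-this)
  have hlim := tendsto_mul_sub_mul (hbd cp cm) (hbd dp dm) (fun n => hbd cp cm (n + 1))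
    (fun n => hbd dp dm (n + 1)) hε ((tendsto_add_atTop_iff_nat 1).2 hε) hη
    ((tendsto_add_atTop_iff_nat 1).2 hη) hmain
  have hα' : Tendsto (fun n => (jacobiAlpha a n : ℂ)⁻¹) atTop (𝓝 (αinf : ℂ)⁻¹) :=
    ((continuous_ofReal.tendsto _).comp hα).inv₀ (ofReal_ne_zero.2 hα0)
  have hW := hα'.mul hlim
  have hconst : ∀ n, (jacobiAlpha a n : ℂ)⁻¹ * ((cp * e n + cm * m n + ε n) *
      (dp * e (n + 1) + dm * m (n + 1) + η (n + 1)) -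
      (cp * e (n + 1) + cm * m (n + 1) + ε (n + 1)) * (dp * e n + dm * m n + η n)) =
      jacobiWronskian a u v 0 := by
    intro n
    rw [← hu.wronskian_eq hv n, jacobiWronskian, hu' n, hu' (n + 1), hv' n, hv' (n + 1)]
    have h0 : (√(a n) : ℂ) ≠ 0 := ofReal_ne_zero.2 (Real.sqrt_pos.2 (ha n)).ne'
    have h1 : (√(a (n + 1)) : ℂ) ≠ 0 := ofReal_ne_zero.2 (Real.sqrt_pos.2 (ha (n + 1))).ne'
    have h2 : (a n : ℂ) = √(a n) * √(a n) := by
      rw [← ofReal_mul, Real.mul_self_sqrt (ha n).le]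
    rw [jacobiAlpha, Real.sqrt_div (ha _).le, h2]
    push_cast
    simp only [he, hm]
    field_simp
  rw [hu.wronskian_eq hv n]
  rw [tendsto_congr hconst] at hW
  rw [tendsto_nhds_unique tendsto_const_nhds hW]
  ring

lemma eq_of_hasJostAsymptotics (ha : ∀ n, 0 < a n) {βinf αinf : ℝ}
    (hβ : Tendsto (jacobiBeta a b β₀) atTop (𝓝 βinf)) (hβinf : |βinf| < 1)
    (hα : Tendsto (jacobiAlpha a) atTop (𝓝 αinf)) (hα0 : αinf ≠ 0) {σp σm τp τm : ℂ}
    (hp : HasJostAsymptotics a b β₀ (jacobiP a b z) σp σm)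
    (hq : HasJostAsymptotics a b β₀ (jacobiQ a b z) τp τm)
    (hu : IsJacobiSolution a b z u) (hv : IsJacobiSolution a b z v)
    (hu' : HasJostAsymptotics a b β₀ u cp cm) (hv' : HasJostAsymptotics a b β₀ v cp cm) :
    u = v := by
  have hd := hu.linearCombination hv 1 (-1)
  have hd' := hu'.linearCombination hv' 1 (-1)
  have hP : IsJacobiSolution a b z (jacobiP a b z) := isJacobiSolution_jacobiRec ha _ _
  have hQ : IsJacobiSolution a b z (jacobiQ a b z) := isJacobiSolution_jacobiRec ha _ _
  have h1 := jacobiWronskian_eq_of_hasJostAsymptotics ha hβ hβinf hα hα0 hd hP hd' hp 0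
  have h2 := jacobiWronskian_eq_of_hasJostAsymptotics ha hβ hβinf hα hα0 hd hQ hd' hq 0
  have h0 : (a 0 : ℂ) ≠ 0 := ofReal_ne_zero.2 (ha _).ne'
  ring_nf at h1 h2
  simp only [jacobiWronskian, jacobiP, jacobiQ, jacobiRec, zero_add] at h1 h2
  -- Since `q_0 = 0`, the Wronskian with `q` at index `0` is just the initial value of the
  -- difference; the Wronskian with `p` then gives the next value.
  have e0 : 1 * u 0 + (-1) * v 0 = 0 := by
    field_simp at h2
    linear_combination h2
  have e1 : 1 * u 1 + (-1) * v 1 = 0 := by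
    have h3 : (a 0 : ℂ) * (1 * u 1 + (-1) * v 1) = 0 := by
      linear_combination -h1 + a 0 * ((z - b 0) / a 0) * e0
    exact (mul_eq_zero.1 h3).resolve_left h0
  funext n
  have := hd.eq_zero ha e0 e1 n
  linear_combination this

end Asymptotics

/-! ### The limit of `α_n` -/

section Alpha

variable {a : ℕ → ℝ}

lemma exists_tendsto_jacobiAlpha (ha : ∀ n, 0 < a n) (hCarl : Summable fun n => (a n)⁻¹)
    (hk : Summable fun n => |jacobiK a n - 1|) :
    ∃ αinf : ℝ, 1 ≤ αinf ∧ Tendsto (jacobiAlpha a) atTop (𝓝 αinf) := by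
  have hpos : ∀ n, 0 < jacobiAlpha a n := fun n => Real.sqrt_pos.2 (div_pos (ha _) (ha _))
  have hk0 : ∀ᶠ n in atTop, |jacobiK a (n + 1) - 1| < 1 / 2 :=
    ((tendsto_add_atTop_iff_nat 1).2 hk.tendsto_atTop_zero).eventually (gt_mem_nhds (by norm_num))
  obtain ⟨N, hN⟩ := eventually_atTop.1 hk0
  -- The increment is `(1 - k_{n+1}) α_{n+1}`. The factor `2` trades `α_{n+1}` for `α_n`, which is
  -- possible once `k_{n+1} > 1/2`.
  obtain ⟨l, hl⟩ := exists_tendsto_of_norm_sub_le (x := fun n => jacobiAlpha a (n + N))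
    (e := fun n => 2 * |jacobiK a (n + N + 1) - 1|) (fun n => by positivity)
    (((summable_nat_add_iff (N + 1)).2 hk).mul_left 2) (fun n => by
      have h1 := hN (n + N) (by lia)
      have h2 : jacobiAlpha a (n + N) = jacobiK a (n + N + 1) * jacobiAlpha a (n + N + 1) := by
        rw [jacobiK, div_mul_cancel₀ _ (hpos _).ne']
      have h3 : jacobiAlpha a (n + 1 + N) - jacobiAlpha a (n + N) =
          (1 - jacobiK a (n + N + 1)) * jacobiAlpha a (n + N + 1) := by
        rw [h2, add_right_comm]; ring
      have h4 : jacobiAlpha a (n + N + 1) ≤ 2 * jacobiAlpha a (n + N) := by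
        rw [h2]; nlinarith [abs_lt.1 h1, hpos (n + N + 1)]
      rw [h3, Real.norm_eq_abs, Real.norm_eq_abs, abs_mul, abs_sub_comm, abs_of_pos (hpos _),
        abs_of_pos (hpos _)]
      nlinarith [abs_nonneg (jacobiK a (n + N + 1) - 1)])
  have hl' := (tendsto_add_atTop_iff_nat N).1 hl
  refine ⟨l, ?_, hl'⟩
  -- A limit below `1` makes `a_n` eventually nonincreasing, so `1 / a_n` cannot tend to `0`.
  by_contra! hlt
  obtain ⟨M, hM⟩ := eventually_atTop.1 (hl'.eventually (gt_mem_nhds hlt))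
  have hdec : ∀ n ≥ M, a (n + 1) ≤ a n := fun n hn => by
    have h1 : a (n + 1) / a n < 1 := by
      have := hM n hn
      rwa [jacobiAlpha, Real.sqrt_lt' one_pos, one_pow] at this
    exact ((div_lt_one (ha n)).1 h1).le
  have hle : ∀ n ≥ M, a n ≤ a M := fun n hn => by
    induction n, hn using Nat.le_induction with
    | base => exact le_rfl
    | succ n hn ih => exact (hdec n hn).trans ih
  have := ge_of_tendsto hCarl.tendsto_atTop_zero
    (eventually_atTop.2 ⟨M, fun n hn => inv_anti₀ (ha n) (hle n hn)⟩)
  exact absurd this (not_le.2 (inv_pos.2 (ha M)))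

end Alpha

/-! ### One step of variation of parameters -/

section VariationOfParameters

/-- Variation of parameters for `k y₂ - (2β + w) y₁ + y₀ = 0`, where `y₀ = c E₀ + d M₀` and
`y₁ = c E₁ + d M₁` with `E₁ = E₀ l₀`, `M₁ = M₀ m₀`. -/
lemma variation_of_parameters_step {y₁ y₂ c d E₀ M₀ E₁ M₁ l₀ m₀ l₁ m₁ k w β γ : ℂ}
    (hγ : γ ≠ 0) (hk : k ≠ 0) (hE : E₁ = E₀ * l₀) (hM : M₁ = M₀ * m₀) (hEM : E₁ * M₁ = 1)
    (hlm : l₀ * m₀ = 1) (hs : l₁ + m₁ = 2 * β) (hd : l₁ - m₁ = 2 * I * γ)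
    (h₁ : y₁ = c * E₁ + d * M₁)
    (hy : k * y₂ - (2 * β + w) * y₁ + (c * E₀ + d * M₀) = 0) :
    M₁ * (y₂ - m₁ * y₁) / (2 * I * γ) - c =
        -M₁ * (c * E₁ * ((k - 1) * l₁ - w + m₀ - m₁) + d * M₁ * ((k - 1) * m₁ - w + l₀ - l₁)) /
          (k * (2 * I * γ)) ∧
      E₁ * (l₁ * y₁ - y₂) / (2 * I * γ) - d =
        E₁ * (c * E₁ * ((k - 1) * l₁ - w + m₀ - m₁) + d * M₁ * ((k - 1) * m₁ - w + l₀ - l₁)) /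
          (k * (2 * I * γ)) := by
  have hδ : k * (y₂ - c * E₁ * l₁ - d * M₁ * m₁) =
      -(c * E₁ * ((k - 1) * l₁ - w + m₀ - m₁) + d * M₁ * ((k - 1) * m₁ - w + l₀ - l₁)) := by
    linear_combination hy + (2 * β + w) * h₁ - (c * E₁ + d * M₁) * hs +
      c * m₀ * hE + d * l₀ * hM + (c * E₀ + d * M₀) * hlm
  have hI : (2 * I * γ) ≠ 0 := mul_ne_zero (mul_ne_zero two_ne_zero I_ne_zero) hγ
  set D := 2 * I * γ
  constructor
  · rw [div_sub' hI, div_eq_div_iff hI (mul_ne_zero hk hI)]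
    linear_combination D * M₁ * hδ - D * k * M₁ * m₁ * h₁ + D * k * c * (l₁ - m₁) * hEM +
      D * k * c * hd
  · rw [div_sub' hI, div_eq_div_iff hI (mul_ne_zero hk hI)]
    linear_combination -D * E₁ * hδ + D * k * E₁ * l₁ * h₁ + D * k * d * (l₁ - m₁) * hEM +
      D * k * d * hd

/-- The product carries the sup norm. The two error terms give `2B`, and the denominator satisfies
`‖k D‖ ≥ (1/2)(2s) = s`. -/
lemma norm_sub_le_of_variation_of_parameters {c d c' d' E M ρ ρ' k D : ℂ} {B s : ℝ} (hs : 0 < s)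
    (hE : ‖E‖ = 1) (hM : ‖M‖ = 1) (hk : 1 / 2 ≤ ‖k‖) (hD : 2 * s ≤ ‖D‖) (hρ : ‖ρ‖ ≤ B)
    (hρ' : ‖ρ'‖ ≤ B)
    (hc : c' - c = -M * (c * E * ρ + d * M * ρ') / (k * D))
    (hd : d' - d = E * (c * E * ρ + d * M * ρ') / (k * D)) :
    ‖((c', d') : ℂ × ℂ) - (c, d)‖ ≤ 2 / s * B * ‖((c, d) : ℂ × ℂ)‖ := by
  have hB : 0 ≤ B := (norm_nonneg _).trans hρ
  have h1 : ‖c * E * ρ + d * M * ρ'‖ ≤ 2 * B * ‖((c, d) : ℂ × ℂ)‖ := by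
    refine (norm_add_le _ _).trans ?_
    simp only [norm_mul, hE, hM, mul_one]
    have hc' : ‖c‖ ≤ ‖((c, d) : ℂ × ℂ)‖ := norm_fst_le (c, d)
    have hd' : ‖d‖ ≤ ‖((c, d) : ℂ × ℂ)‖ := norm_snd_le (c, d)
    calc ‖c‖ * ‖ρ‖ + ‖d‖ * ‖ρ'‖ ≤ ‖((c, d) : ℂ × ℂ)‖ * B + ‖((c, d) : ℂ × ℂ)‖ * B := by gcongr
      _ = _ := by ring
  have h2 : s ≤ ‖k * D‖ := by
    rw [norm_mul]
    calc s = 1 / 2 * (2 * s) := by ring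
      _ ≤ _ := by gcongr
  have h3 : ‖c * E * ρ + d * M * ρ'‖ / ‖k * D‖ ≤ 2 / s * B * ‖((c, d) : ℂ × ℂ)‖ :=
    calc ‖c * E * ρ + d * M * ρ'‖ / ‖k * D‖ ≤ 2 * B * ‖((c, d) : ℂ × ℂ)‖ / s := by gcongr
      _ = _ := by ring
  rw [Prod.mk_sub_mk, Prod.norm_def]
  refine max_le ?_ ?_
  · simpa only [hc, norm_div, norm_mul, norm_neg, hM, one_mul] using h3
  · simpa only [hd, norm_div, norm_mul, hE, one_mul] using h3

end VariationOfParameters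

/-! ### Asymptotics of arbitrary holomorphic families of solutions -/

section JostAsymptotics

variable {a b : ℕ → ℝ} {β₀ : ℝ} {z : ℂ}

/-- With `u_n = a_n^{-1/2} y_n` the Jacobi equation becomes
`k_{n+1} y_{n+2} - (2 β_{n+1} + z / √(a_n a_{n+1})) y_{n+1} + y_n = 0`. -/
lemma IsJacobiSolution.normalized (ha : ∀ n, 0 < a n) {u : ℕ → ℂ} (hu : IsJacobiSolution a b z u)
    (n : ℕ) :
    (jacobiK a (n + 1) : ℂ) * ((√(a (n + 2)) : ℂ) * u (n + 2)) -
      (2 * (jacobiBeta a b β₀ (n + 1) : ℂ) + z * ((√(a n * a (n + 1)))⁻¹ : ℝ)) *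
        ((√(a (n + 1)) : ℂ) * u (n + 1)) + (√(a n) : ℂ) * u n = 0 := by
  have hs : ∀ n, (√(a n) : ℂ) ≠ 0 := fun n => ofReal_ne_zero.2 (Real.sqrt_pos.2 (ha n)).ne'
  have h2 : ∀ n, (a n : ℂ) = √(a n) ^ 2 := fun n => by
    rw [← ofReal_pow, Real.sq_sqrt (ha n).le]
  have h := hu n
  rw [h2 n, h2 (n + 1)] at h
  simp only [jacobiK, jacobiAlpha, jacobiBeta, Real.sqrt_div (ha _).le, Real.sqrt_mul (ha _).le]
  push_cast
  have := hs n
  have := hs (n + 1)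
  have := hs (n + 2)
  field_simp
  linear_combination h

lemma summable_inv_sqrt_mul_succ (ha : ∀ n, 0 < a n) (hCarl : Summable fun n => (a n)⁻¹) :
    Summable fun n => (√(a n * a (n + 1)))⁻¹ := by
  refine Summable.of_nonneg_of_le (fun n => by positivity) (fun n => ?_)
    (hCarl.add ((summable_nat_add_iff 1).2 hCarl))
  have h0 := ha n
  have h1 := ha (n + 1)
  rw [← Real.sqrt_inv, mul_inv]
  refine Real.sqrt_le_iff.2 ⟨by positivity, ?_⟩
  have := inv_pos.2 h0
  have := inv_pos.2 h1
  nlinarith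

/-- Difference of squares: the sum of the roots is at least `2s`, while `|x + y| ≤ 2`. This
transfers bounded variation from `β_n` to the imaginary part of the characteristic roots. -/
lemma abs_sqrt_one_sub_sq_sub_le {x y s : ℝ} (hx1 : |x| ≤ 1) (hy1 : |y| ≤ 1) (hs : 0 < s)
    (hx : s ≤ √(1 - x ^ 2)) (hy : s ≤ √(1 - y ^ 2)) :
    |√(1 - x ^ 2) - √(1 - y ^ 2)| ≤ |x - y| / s := by
  have ex : √(1 - x ^ 2) ^ 2 = 1 - x ^ 2 := Real.sq_sqrt (by nlinarith [abs_le.1 hx1])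
  have ey : √(1 - y ^ 2) ^ 2 = 1 - y ^ 2 := Real.sq_sqrt (by nlinarith [abs_le.1 hy1])
  rw [le_div_iff₀ hs]
  have h1 : |√(1 - x ^ 2) - √(1 - y ^ 2)| * (√(1 - x ^ 2) + √(1 - y ^ 2)) = |x - y| * |x + y| := by
    rw [← abs_of_pos (show 0 < √(1 - x ^ 2) + √(1 - y ^ 2) by linarith), ← abs_mul, ← abs_mul,
      ← abs_neg ((x - y) * (x + y))]
    congr 1
    linear_combination ex - ey
  have h2 : |x + y| ≤ 2 := (abs_add_le x y).trans (by linarith)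
  nlinarith [abs_nonneg (√(1 - x ^ 2) - √(1 - y ^ 2)), abs_nonneg (x - y)]

/-- Solutions depending holomorphically on `z` have asymptotics with entire coefficients. -/
lemma exists_hasJostAsymptotics (ha : ∀ n, 0 < a n) {βinf : ℝ}
    (hCarl : Summable fun n => (a n)⁻¹)
    (hβ : Tendsto (jacobiBeta a b β₀) atTop (𝓝 βinf)) (hβinf : |βinf| < 1)
    (hk : Summable fun n => |jacobiK a n - 1|)
    (hβ' : Summable fun n => |jacobiBeta a b β₀ (n + 1) - jacobiBeta a b β₀ n|)
    {u : ℂ → ℕ → ℂ} (hu : ∀ z, IsJacobiSolution a b z (u z))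
    (hdiff : ∀ n, Differentiable ℂ fun z => u z n) :
    ∃ σp σm : ℂ → ℂ, Differentiable ℂ σp ∧ Differentiable ℂ σm ∧
      ∀ z, HasJostAsymptotics a b β₀ (u z) (σp z) (σm z) := by
  set β := jacobiBeta a b β₀ with hβdef
  set γ : ℕ → ℝ := fun n => √(1 - β n ^ 2) with hγdef
  set s : ℝ := √(1 - βinf ^ 2) / 2 with hsdef
  have hs : 0 < s := by
    have : 0 < √(1 - βinf ^ 2) := Real.sqrt_pos.2 (by nlinarith [abs_lt.1 hβinf])
    positivity
  have hev1 : ∀ᶠ n in atTop, |β n| ≤ 1 :=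
    (hβ.abs.eventually (gt_mem_nhds hβinf)).mono fun n hn => hn.le
  have hev2 : ∀ᶠ n in atTop, s ≤ γ n := by
    have h1 : Tendsto γ atTop (𝓝 √(1 - βinf ^ 2)) := ((hβ.pow 2).const_sub 1).sqrt
    exact (h1.eventually (lt_mem_nhds (by linarith : s < √(1 - βinf ^ 2)))).mono
      fun n hn => hn.le
  have hev3 : ∀ᶠ n in atTop, |jacobiK a (n + 1) - 1| < 1 / 2 :=
    ((tendsto_add_atTop_iff_nat 1).2 hk.tendsto_atTop_zero).eventually (gt_mem_nhds (by norm_num))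
  -- From `N` on, every index contributes to the phase, the roots `l`, `l'` are unimodular and
  -- uniformly separated, and `k_{n+1} > 1/2`.
  obtain ⟨N, hN⟩ := eventually_atTop.1 (hev1.and (hev2.and hev3))
  set e : ℕ → ℂ := fun n => exp (I * (jacobiPhase a b β₀ n : ℂ)) with he
  set m : ℕ → ℂ := fun n => exp (-I * (jacobiPhase a b β₀ n : ℂ)) with hm
  have hem : ∀ n, e n * m n = 1 := fun n => by simp only [he, hm, ← Complex.exp_add]; simp
  have he1 : ∀ n, ‖e n‖ = 1 := fun n => norm_exp_I_mul_ofReal _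
  have hm1 : ∀ n, ‖m n‖ = 1 := fun n => norm_exp_neg_I_mul_ofReal _
  set l : ℕ → ℂ := fun n => β n + I * γ n with hl
  set l' : ℕ → ℂ := fun n => β n - I * γ n with hl'
  have hestep : ∀ n ≥ N, e (n + 1) = e n * l n := fun n hn =>
    exp_I_mul_jacobiPhase_succ (hN n hn).1
  have hmstep : ∀ n ≥ N, m (n + 1) = m n * l' n := fun n hn =>
    exp_neg_I_mul_jacobiPhase_succ (hN n hn).1
  have hll' : ∀ n ≥ N, l n * l' n = 1 := fun n hn => by
    have h1 := hem (n + 1)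
    rw [hestep n hn, hmstep n hn] at h1
    linear_combination h1 - l n * l' n * hem n
  have hl1 : ∀ n ≥ N, ‖l n‖ = 1 := fun n hn => by
    have := he1 (n + 1)
    rwa [hestep n hn, norm_mul, he1, one_mul] at this
  have hl1' : ∀ n ≥ N, ‖l' n‖ = 1 := fun n hn => by
    have := hm1 (n + 1)
    rwa [hmstep n hn, norm_mul, hm1, one_mul] at this
  have hγ0 : ∀ n ≥ N, (γ n : ℂ) ≠ 0 := fun n hn =>
    ofReal_ne_zero.2 (hs.trans_le (hN n hn).2.1).ne'
  set y : ℕ → ℂ → ℂ := fun n z => (√(a n) : ℂ) * u z n with hy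
  -- Cramer's rule for `y_n = c e_n + d m_n`, `y_{n+1} = c e_{n+1} + d m_{n+1}`, using `1 / e_n =
  -- m_n` and `l_n - l'_n = 2iγ_n`.
  set c : ℕ → ℂ → ℂ := fun n z => m n * (y (n + 1) z - l' n * y n z) / (2 * I * γ n) with hc
  set d : ℕ → ℂ → ℂ := fun n z => e n * (l n * y n z - y (n + 1) z) / (2 * I * γ n) with hd
  have hy0 : ∀ n ≥ N, ∀ z, y n z = c n z * e n + d n z * m n := fun n hn z => by
    have h0 := hγ0 n hn
    have : (2 * I * (γ n : ℂ)) ≠ 0 := mul_ne_zero (mul_ne_zero two_ne_zero I_ne_zero) h0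
    simp only [hc, hd]
    rw [div_mul_eq_mul_div, div_mul_eq_mul_div, ← add_div, eq_div_iff this]
    simp only [hl, hl']
    linear_combination (-(2 * I * (γ n : ℂ)) * y n z) * hem n
  have hy1 : ∀ n ≥ N, ∀ z, y (n + 1) z = c n z * e (n + 1) + d n z * m (n + 1) := fun n hn z => by
    have h0 := hγ0 n hn
    have : (2 * I * (γ n : ℂ)) ≠ 0 := mul_ne_zero (mul_ne_zero two_ne_zero I_ne_zero) h0
    rw [hestep n hn, hmstep n hn]
    simp only [hc, hd]
    rw [div_mul_eq_mul_div, div_mul_eq_mul_div, ← add_div, eq_div_iff this]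
    simp only [hl, hl']
    linear_combination (-(2 * I * (γ n : ℂ)) * y (n + 1) z) * hem n
  set r : ℕ → ℝ := fun n => (√(a n * a (n + 1)))⁻¹ with hr
  have hr0 : ∀ n, 0 ≤ r n := fun n => by positivity
  -- The factor `1 + 1/s` bounds the change of a root: `1` for its real part `β`, `1/s` for its
  -- imaginary part `γ`.
  set w : ℕ → ℝ := fun n =>
    |jacobiK a (n + 1) - 1| + r n + (1 + 1 / s) * |β (n + 1) - β n| with hw
  have hwsum : Summable w := (((summable_nat_add_iff 1).2 hk).add
    (summable_inv_sqrt_mul_succ ha hCarl)).add (hβ'.mul_left _)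
  have hw0 : ∀ n, 0 ≤ w n := fun n => by
    have := hr0 n
    positivity
  have hstep : ∀ n ≥ N, ∀ z, ‖((c (n + 1) z, d (n + 1) z) : ℂ × ℂ) - (c n z, d n z)‖ ≤
      2 / s * w n * (1 + ‖z‖) * ‖((c n z, d n z) : ℂ × ℂ)‖ := by
    intro n hn z
    have hn1 : n + 1 ≥ N := by lia
    have hkn := (hN n hn).2.2
    have hk2 : 1 / 2 ≤ ‖(jacobiK a (n + 1) : ℂ)‖ := by
      rw [norm_real, Real.norm_eq_abs]
      exact le_trans (by linarith [(abs_lt.1 hkn).1]) (le_abs_self _)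
    have hk0 : (jacobiK a (n + 1) : ℂ) ≠ 0 := norm_pos_iff.1 (by linarith)
    have hrec := (hu z).normalized (β₀ := β₀) ha n
    obtain ⟨h1, h2⟩ := variation_of_parameters_step (y₁ := y (n + 1) z) (y₂ := y (n + 2) z)
      (c := c n z) (d := d n z) (k := jacobiK a (n + 1)) (w := z * r n) (β := β (n + 1))
      (hγ0 (n + 1) hn1) hk0 (hestep n hn) (hmstep n hn) (hem (n + 1)) (hll' n hn)
      (show l (n + 1) + l' (n + 1) = _ by simp only [hl, hl']; ring)
      (show l (n + 1) - l' (n + 1) = _ by simp only [hl, hl']; ring) (hy1 n hn z)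
      (by rw [← hy0 n hn z]; exact hrec)
    have hγdiff : |γ (n + 1) - γ n| ≤ |β (n + 1) - β n| / s :=
      abs_sqrt_one_sub_sq_sub_le (hN _ hn1).1 (hN _ hn).1 hs (hN _ hn1).2.1 (hN _ hn).2.1
    have hnormdiff : ‖((β (n + 1) - β n : ℝ) : ℂ)‖ + ‖I * ((γ (n + 1) - γ n : ℝ) : ℂ)‖ ≤
        (1 + 1 / s) * |β (n + 1) - β n| := by
      rw [norm_mul, norm_I, one_mul, norm_real, norm_real, Real.norm_eq_abs, Real.norm_eq_abs]
      calc _ ≤ |β (n + 1) - β n| + |β (n + 1) - β n| / s := by gcongr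
        _ = _ := by ring
    have hB : ∀ x t : ℂ, ‖x‖ = 1 → ‖t‖ ≤ (1 + 1 / s) * |β (n + 1) - β n| →
        ‖((jacobiK a (n + 1) : ℂ) - 1) * x - z * r n + t‖ ≤ w n * (1 + ‖z‖) := by
      intro x t hx ht
      have e1 : ‖(jacobiK a (n + 1) : ℂ) - 1‖ = |jacobiK a (n + 1) - 1| := by
        rw [← ofReal_one, ← ofReal_sub, norm_real, Real.norm_eq_abs]
      have e2 : ‖(r n : ℂ)‖ = r n := by rw [norm_real, Real.norm_of_nonneg (hr0 n)]
      refine (norm_add_le _ _).trans ((add_le_add (norm_sub_le _ _) ht).trans ?_)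
      rw [norm_mul, norm_mul, hx, e1, e2, mul_one]
      have p1 : 0 ≤ |jacobiK a (n + 1) - 1| * ‖z‖ := by positivity
      have p2 : 0 ≤ (1 + 1 / s) * |β (n + 1) - β n| * ‖z‖ := by positivity
      have := hr0 n
      simp only [hw]
      linarith
    have hD : 2 * s ≤ ‖2 * I * (γ (n + 1) : ℂ)‖ := by
      rw [norm_mul, norm_mul, norm_I, mul_one, norm_ofNat, norm_real]
      have := (hN _ hn1).2.1
      exact mul_le_mul_of_nonneg_left (this.trans (le_abs_self _)) zero_le_two
    have hfin := norm_sub_le_of_variation_of_parameters hs (he1 (n + 1)) (hm1 (n + 1)) hk2 hD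
      (B := w n * (1 + ‖z‖)) ?_ ?_ h1 h2
    · exact hfin.trans_eq (by ring)
    · rw [add_sub_assoc]
      refine hB _ _ (hl1 _ hn1) (le_trans ?_ hnormdiff)
      refine le_trans (le_of_eq ?_) (norm_sub_le _ _)
      rw [← norm_neg]
      congr 1
      simp only [hl']; push_cast; ring
    · rw [add_sub_assoc]
      refine hB _ _ (hl1' _ hn1) (le_trans ?_ hnormdiff)
      refine le_trans (le_of_eq ?_) (norm_add_le _ _)
      rw [← norm_neg]
      congr 1
      simp only [hl]; push_cast; ring
  have hydiff : ∀ n, Differentiable ℂ (y n) := fun n => (hdiff n).const_mul _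
  have hcdiff : ∀ n, Differentiable ℂ (c n) := fun n =>
    (((hydiff (n + 1)).sub ((hydiff n).const_mul _)).const_mul _).div_const _
  have hddiff : ∀ n, Differentiable ℂ (d n) := fun n =>
    ((((hydiff n).const_mul _).sub (hydiff (n + 1))).const_mul _).div_const _
  obtain ⟨L, hLd, hL⟩ := exists_differentiable_tendsto_of_norm_sub_le
    (C := fun n z => ((c (n + N) z, d (n + N) z) : ℂ × ℂ)) (e := fun n => 2 / s * w (n + N))
    (fun n => (hcdiff _).prodMk (hddiff _))
    (fun n => mul_nonneg (by positivity) (hw0 _)) (((summable_nat_add_iff N).2 hwsum).mul_left _)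
    (fun n z => by
      rw [add_right_comm]
      exact hstep (n + N) (by lia) z)
  refine ⟨fun z => (L z).1, fun z => (L z).2, hLd.fst, hLd.snd, fun z => ?_⟩
  -- The error is defined as the exact discrepancy, so the identity holds for every `n`; only its
  -- limit uses the decomposition valid from `N` on.
  refine ⟨fun n => y n z - ((L z).1 * e n + (L z).2 * m n), ?_, fun n => ?_⟩
  · have hcl : Tendsto (fun n => c n z) atTop (𝓝 (L z).1) :=
      (tendsto_add_atTop_iff_nat N).1 ((continuous_fst.tendsto _).comp (hL z))
    have hdl : Tendsto (fun n => d n z) atTop (𝓝 (L z).2) :=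
      (tendsto_add_atTop_iff_nat N).1 ((continuous_snd.tendsto _).comp (hL z))
    have h1 := tendsto_mul_zero_of_norm_le_one (fun n => (he1 n).le)
      (tendsto_sub_nhds_zero_iff.2 hcl)
    have h2 := tendsto_mul_zero_of_norm_le_one (fun n => (hm1 n).le)
      (tendsto_sub_nhds_zero_iff.2 hdl)
    have h3 := h1.add h2
    rw [add_zero] at h3
    refine h3.congr' ?_
    filter_upwards [eventually_ge_atTop N] with n hn
    rw [hy0 n hn z]
    ring
  · have h0 : (√(a n) : ℂ) ≠ 0 := ofReal_ne_zero.2 (Real.sqrt_pos.2 (ha n)).ne'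
    simp only [he, hm, hy]
    push_cast
    field_simp
    ring

end JostAsymptotics

/-! ### Jost solutions as combinations of `p` and `q` -/

theorem theorem3p3 (a b : ℕ → ℝ) (β₀ βinf : ℝ)
    (ha : ∀ n, 0 < a n)
    (hCarl : Summable fun n => (a n)⁻¹)
    (hβ : Tendsto (jacobiBeta a b β₀) atTop (𝓝 βinf))
    (hβinf : |βinf| < 1)
    (hk : Summable fun n => |jacobiK a n - 1|)
    (hβ' : Summable fun n => |jacobiBeta a b β₀ (n + 1) - jacobiBeta a b β₀ n|) :
    ∃ αinf : ℝ, 1 ≤ αinf ∧ Tendsto (jacobiAlpha a) atTop (𝓝 αinf) ∧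
      (∀ z : ℂ, ∃! f : ℕ → ℂ, IsJostSolution a b β₀ 1 z f) ∧
      (∀ z : ℂ, ∃! f : ℕ → ℂ, IsJostSolution a b β₀ (-1) z f) ∧
      ∀ fp fm : ℂ → ℕ → ℂ,
        (∀ z, IsJostSolution a b β₀ 1 z (fp z)) →
        (∀ z, IsJostSolution a b β₀ (-1) z (fm z)) →
        (∀ z n, jacobiWronskian a (fp z) (fm z) n
          = -(2 * I * ((√(1 - βinf ^ 2) : ℝ) : ℂ)) / (αinf : ℂ)) ∧
        ∃ σp σm τp τm : ℂ → ℂ,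
          (Differentiable ℂ σp ∧ Differentiable ℂ σm ∧
            Differentiable ℂ τp ∧ Differentiable ℂ τm) ∧
          -- the coefficients as Wronskians with the Jost solutions
          (∀ z n,
            σp z = -((αinf : ℂ) * jacobiWronskian a (jacobiP a b z) (fm z) n /
              (2 * I * ((√(1 - βinf ^ 2) : ℝ) : ℂ))) ∧
            σm z = (αinf : ℂ) * jacobiWronskian a (jacobiP a b z) (fp z) n /
              (2 * I * ((√(1 - βinf ^ 2) : ℝ) : ℂ)) ∧
            τp z = -((αinf : ℂ) * jacobiWronskian a (jacobiQ a b z) (fm z) n /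
              (2 * I * ((√(1 - βinf ^ 2) : ℝ) : ℂ))) ∧
            τm z = (αinf : ℂ) * jacobiWronskian a (jacobiQ a b z) (fp z) n /
              (2 * I * ((√(1 - βinf ^ 2) : ℝ) : ℂ))) ∧
          -- the polynomials as linear combinations of the Jost solutions
          (∀ z n, jacobiP a b z n = σp z * fp z n + σm z * fm z n ∧
            jacobiQ a b z n = τp z * fp z n + τm z * fm z n) ∧
          -- the asymptotics
          (∀ z, HasJostAsymptotics a b β₀ (jacobiP a b z) (σp z) (σm z) ∧
            HasJostAsymptotics a b β₀ (jacobiQ a b z) (τp z) (τm z)) := by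

  obtain ⟨α, hα1, hα⟩ := exists_tendsto_jacobiAlpha ha hCarl hk
  have hα0 : α ≠ 0 := by positivity
  have hP : ∀ z, IsJacobiSolution a b z (jacobiP a b z) := fun z =>
    isJacobiSolution_jacobiRec ha _ _
  have hQ : ∀ z, IsJacobiSolution a b z (jacobiQ a b z) := fun z =>
    isJacobiSolution_jacobiRec ha _ _
  obtain ⟨σp, σm, hσp, hσm, hPas⟩ := exists_hasJostAsymptotics (β₀ := β₀) ha hCarl hβ hβinf hk hβ'
    hP (fun n => differentiable_jacobiRec _ (by fun_prop) n)
  obtain ⟨τp, τm, hτp, hτm, hQas⟩ := exists_hasJostAsymptotics (β₀ := β₀) ha hCarl hβ hβinf hk hβ'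
    hQ (fun n => differentiable_jacobiRec _ (by fun_prop) n)
  have hW := fun {z : ℂ} {u v : ℕ → ℂ} {cp cm dp dm : ℂ} (hu : IsJacobiSolution a b z u)
    (hv : IsJacobiSolution a b z v) (hu' : HasJostAsymptotics a b β₀ u cp cm)
    (hv' : HasJostAsymptotics a b β₀ v dp dm) (n : ℕ) =>
    jacobiWronskian_eq_of_hasJostAsymptotics ha hβ hβinf hα hα0 hu hv hu' hv' n
  have huniq := fun {z : ℂ} {u v : ℕ → ℂ} {cp cm : ℂ} (hu : IsJacobiSolution a b z u)
    (hv : IsJacobiSolution a b z v) (hu' : HasJostAsymptotics a b β₀ u cp cm)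
    (hv' : HasJostAsymptotics a b β₀ v cp cm) =>
    eq_of_hasJostAsymptotics ha hβ hβinf hα hα0 (hPas z) (hQas z) hu hv hu' hv'
  have hαC : (α : ℂ) ≠ 0 := ofReal_ne_zero.2 hα0
  have hs : ((√(1 - βinf ^ 2) : ℝ) : ℂ) ≠ 0 :=
    ofReal_ne_zero.2 (Real.sqrt_pos.2 (by nlinarith [abs_lt.1 hβinf])).ne'
  set s : ℂ := ((√(1 - βinf ^ 2) : ℝ) : ℂ)
  -- Otherwise the Wronskian of `p` and `q` would vanish, but it is `1`.
  have hdet : ∀ z, σp z * τm z - σm z * τp z ≠ 0 := fun z h => by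
    have h1 := hW (hP z) (hQ z) (hPas z) (hQas z) 0
    rw [h, mul_zero, jacobiWronskian_jacobiP_jacobiQ ha] at h1
    exact one_ne_zero h1
  refine ⟨α, hα1, hα, fun z => ?_, fun z => ?_, fun fp fm hfp hfm => ?_⟩
  · have hD := hdet z
    -- The weights are the row of the inverse coefficient matrix that produces the asymptotic
    -- coefficients `(1, 0)`; the other row gives `(0, 1)` below.
    have h1 := (hP z).linearCombination (hQ z) (τm z / (σp z * τm z - σm z * τp z))
      (-σm z / (σp z * τm z - σm z * τp z))
    have h2 := (hPas z).linearCombination (hQas z) (τm z / (σp z * τm z - σm z * τp z))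
      (-σm z / (σp z * τm z - σm z * τp z))
    rw [show τm z / (σp z * τm z - σm z * τp z) * σp z +
      -σm z / (σp z * τm z - σm z * τp z) * τp z = 1 by rw [← mul_inv_cancel₀ hD]; ring,
      show τm z / (σp z * τm z - σm z * τp z) * σm z +
      -σm z / (σp z * τm z - σm z * τp z) * τm z = 0 by ring] at h2
    refine ⟨_, isJostSolution_one_iff.2 ⟨h1, h2⟩, fun g hg => ?_⟩
    obtain ⟨hg1, hg2⟩ := isJostSolution_one_iff.1 hg
    exact huniq hg1 h1 hg2 h2
  · have hD := hdet z
    have h1 := (hP z).linearCombination (hQ z) (-τp z / (σp z * τm z - σm z * τp z))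
      (σp z / (σp z * τm z - σm z * τp z))
    have h2 := (hPas z).linearCombination (hQas z) (-τp z / (σp z * τm z - σm z * τp z))
      (σp z / (σp z * τm z - σm z * τp z))
    rw [show -τp z / (σp z * τm z - σm z * τp z) * σp z +
      σp z / (σp z * τm z - σm z * τp z) * τp z = 0 by ring,
      show -τp z / (σp z * τm z - σm z * τp z) * σm z +
      σp z / (σp z * τm z - σm z * τp z) * τm z = 1 by rw [← mul_inv_cancel₀ hD]; ring] at h2
    refine ⟨_, isJostSolution_neg_one_iff.2 ⟨h1, h2⟩, fun g hg => ?_⟩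
    obtain ⟨hg1, hg2⟩ := isJostSolution_neg_one_iff.1 hg
    exact huniq hg1 h1 hg2 h2
  · replace hfp := fun z => isJostSolution_one_iff.1 (hfp z)
    replace hfm := fun z => isJostSolution_neg_one_iff.1 (hfm z)
    -- Against `(0, 1)` the coefficient determinant is `cp`, against `(1, 0)` it is `-cm`, whence
    -- the opposite signs.
    have hcoef : ∀ {z : ℂ} {u : ℕ → ℂ} {cp cm : ℂ}, IsJacobiSolution a b z u →
        HasJostAsymptotics a b β₀ u cp cm → ∀ n,
        cp = -((α : ℂ) * jacobiWronskian a u (fm z) n / (2 * I * s)) ∧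
        cm = (α : ℂ) * jacobiWronskian a u (fp z) n / (2 * I * s) := by
      intro z u cp cm hu hu' n
      rw [hW hu (hfm z).1 hu' (hfm z).2 n, hW hu (hfp z).1 hu' (hfp z).2 n]
      constructor <;> (field_simp; ring)
    have hexp : ∀ {z : ℂ} {u : ℕ → ℂ} {cp cm : ℂ}, IsJacobiSolution a b z u →
        HasJostAsymptotics a b β₀ u cp cm → ∀ n, u n = cp * fp z n + cm * fm z n := by
      intro z u cp cm hu hu' n
      have h1 := (hfp z).1.linearCombination (hfm z).1 cp cm
      have h2 := (hfp z).2.linearCombination (hfm z).2 cp cm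
      simp only [mul_one, mul_zero, add_zero, zero_add] at h2
      exact congrFun (huniq hu h1 hu' h2) n
    refine ⟨fun z n => ?_, σp, σm, τp, τm, ⟨hσp, hσm, hτp, hτm⟩, fun z n => ?_, fun z n => ?_,
      fun z => ⟨hPas z, hQas z⟩⟩
    · rw [hW (hfp z).1 (hfm z).1 (hfp z).2 (hfm z).2 n]
      ring
    · obtain ⟨h1, h2⟩ := hcoef (hP z) (hPas z) n
      obtain ⟨h3, h4⟩ := hcoef (hQ z) (hQas z) n
      exact ⟨h1, h2, h3, h4⟩
    · exact ⟨hexp (hP z) (hPas z) n, hexp (hQ z) (hQas z) n⟩
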